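/- Let $\mathbb{T}^1=\mathbb{R}/2\pi\mathbb{Z}$. Let $\mathcal{S}(\mathbb{T}^1\times\mathbb{R})$ be the Fréchet space of smooth functions $f:\mathbb{T}^1\times\mathbb{R}\to\mathbb{C}$ with $\sup_{t,x}|x^\gamma\partial_t^\alpha\partial_x^\beta f(t,x)|<\infty$ for all $\alpha,\beta,\gamma\in\mathbb{N}_0$, and let $\mathcal{S}'(\mathbb{T}^1\times\mathbb{R})$ be its topological dual, in which $\mathcal{S}(\mathbb{T}^1\times\mathbb{R})$ is embedded by $\langle f,g\rangle=\int_{\mathbb{T}^1\times\mathbb{R}} f g\,dt\,dx$. Let $a\in C^\infty(\mathbb{T}^1;\mathbb{R})$, $q\in C^\infty(\mathbb{T}^1;\mathbb{C})$, and let $$a_0=\frac1{2\pi}\int_0^{2\pi}a(t)\,dt,\quad q_0=\frac1{2\pi}\int_0^{2\pi}q(t)\,dt,\quad A(t)=\int_0^t a(s)\,ds-a_0t,\quad Q(t)=\int_0^t q(s)\,ds-q_0t.$$ Consider on $\mathcal{S}'(\mathbb{T}^1\times\mathbb{R})$ the operators $$L=\partial_t+a(t)\partial_x+q(t),\qquad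 L_0=\partial_t+a_0\partial_x+q_0,$$ $$\Psi_a u=\mathcal{F}_{\mathbb{R}}^{-1}\{e^{i\xi A(t)}\,\mathcal{F}_{\mathbb{R}}u(t,\xi)\},\qquad \Psi_q u=e^{Q(t)}u,\qquad \Psi=\Psi_a\circ\Psi_q,$$ where $\mathcal{F}_{\mathbb{R}}$ is the partial Fourier transform in $x$, $\mathcal{F}_{\mathbb{R}}f(t,\xi)=\int_{\mathbb{R}}f(t,x)e^{-ix\xi}\,dx$ on $\mathcal{S}(\mathbb{T}^1\times\mathbb{R})$, with inverse $\mathcal{F}_{\mathbb{R}}^{-1}g(t,x)=\frac{1}{2\pi}\int_{\mathbb{R}}g(t,\xi)e^{ix\xi}\,d\xi$, both extended to $\mathcal{S}'(\mathbb{T}^1\times\mathbb{R})$ by $\langle\mathcal{F}_{\mathbb{R}}^{\pm1}u,f\rangle=\langle u,\mathcal{F}_{\mathbb{R}}^{\pm1}f\rangle$. Then: 1. $\Psi$ restricts to an automorphism (linear homeomorphism onto itself) of $\mathcal{S}(\mathbb{T}^1\times\mathbb{R})$, given there by the same formulas. 2. $\Psi$ is a linear bijection of $\mathcal{S}'(\mathbb{T}^1\times\mathbb{R})$,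 and $L_0\circ\Psi=\Psi\circ L$ and $L\circ\Psi^{-1}=\Psi^{-1}\circ L_0$. 3. $L$ is Schwartz globally hypoelliptic if and only if $L_0$ is, where an operator $P$ on $\mathcal{S}'(\mathbb{T}^1\times\mathbb{R})$ is Schwartz globally hypoelliptic if $u\in\mathcal{S}'(\mathbb{T}^1\times\mathbb{R})$ and $Pu\in\mathcal{S}(\mathbb{T}^1\times\mathbb{R})$ imply $u\in\mathcal{S}(\mathbb{T}^1\times\mathbb{R})$. -/

import Mathlib

noncomputable section

namespace TorusLine

open scoped ContDiff
open MeasureTheory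

/-- The partial derivative `∂_t` of a function of `(t, x)`. -/
def dt (f : ℝ × ℝ → ℂ) (p : ℝ × ℝ) : ℂ := deriv (fun s => f (s, p.2)) p.1

/-- The partial derivative `∂_x` of a function of `(t, x)`. -/
def dx (f : ℝ × ℝ → ℂ) (p : ℝ × ℝ) : ℂ := deriv (fun y => f (p.1, y)) p.2

/-- The mixed partial derivative `∂_t^α ∂_x^β f`. -/
def mixedDeriv (α β : ℕ) (f : ℝ × ℝ → ℂ) : ℝ × ℝ → ℂ := dt^[α] (dx^[β] f)

/-- Functions on `𝕋¹ × ℝ`, `𝕋¹ = ℝ / 2πℤ`, seen as functions on `ℝ × ℝ`. -/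
def PeriodicT (f : ℝ × ℝ → ℂ) : Prop := ∀ t x, f (t + 2 * Real.pi, x) = f (t, x)

theorem dt_eq {f : ℝ × ℝ → ℂ} (hf : ContDiff ℝ ∞ f) : dt f = fun p => fderiv ℝ f p (1, 0) := by
  funext p
  have h1 : HasFDerivAt f (fderiv ℝ f p) (p.1, p.2) :=
    (hf.differentiable (by simp) p).hasFDerivAt
  have h2 : HasDerivAt (fun s : ℝ => (s, p.2)) ((1 : ℝ), (0 : ℝ)) p.1 :=
    (hasDerivAt_id p.1).prodMk (hasDerivAt_const p.1 p.2)
  exact (h1.comp_hasDerivAt p.1 h2).deriv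

theorem dx_eq {f : ℝ × ℝ → ℂ} (hf : ContDiff ℝ ∞ f) : dx f = fun p => fderiv ℝ f p (0, 1) := by
  funext p
  have h1 : HasFDerivAt f (fderiv ℝ f p) (p.1, p.2) :=
    (hf.differentiable (by simp) p).hasFDerivAt
  have h2 : HasDerivAt (fun s : ℝ => (p.1, s)) ((0 : ℝ), (1 : ℝ)) p.2 :=
    (hasDerivAt_const p.2 p.1).prodMk (hasDerivAt_id p.2)
  exact (h1.comp_hasDerivAt p.2 h2).deriv

theorem smooth_dt {f : ℝ × ℝ → ℂ} (hf : ContDiff ℝ ∞ f) : ContDiff ℝ ∞ (dt f) := by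
  rw [dt_eq hf]
  exact (hf.fderiv_right (m := ∞) (by simp)).clm_apply contDiff_const

theorem smooth_dx {f : ℝ × ℝ → ℂ} (hf : ContDiff ℝ ∞ f) : ContDiff ℝ ∞ (dx f) := by
  rw [dx_eq hf]
  exact (hf.fderiv_right (m := ∞) (by simp)).clm_apply contDiff_const

theorem fderiv_eq {f : ℝ × ℝ → ℂ} (hf : ContDiff ℝ ∞ f) (p v : ℝ × ℝ) :
    fderiv ℝ f p v = v.1 * dt f p + v.2 * dx f p := by
  rw [dt_eq hf, dx_eq hf]
  have : v = v.1 • ((1 : ℝ), (0 : ℝ)) + v.2 • ((0 : ℝ), (1 : ℝ)) := by simp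
  conv_lhs => rw [this, map_add, map_smul, map_smul]
  simp

theorem dx_dt {f : ℝ × ℝ → ℂ} (hf : ContDiff ℝ ∞ f) : dx (dt f) = dt (dx f) := by
  rw [dx_eq (smooth_dt hf), dt_eq (smooth_dx hf), dt_eq hf, dx_eq hf]
  funext p
  have hd : DifferentiableAt ℝ (fderiv ℝ f) p :=
    (hf.fderiv_right (m := ∞) (by simp)).differentiable (by simp) p
  have hs : IsSymmSndFDerivAt ℝ f p := hf.contDiffAt.isSymmSndFDerivAt
    (by rw [minSmoothness_of_isRCLikeNormedField]; exact WithTop.coe_le_coe.2 le_top)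
  have e (v w : ℝ × ℝ) : fderiv ℝ (fun q => fderiv ℝ f q v) p w = fderiv ℝ (fderiv ℝ f) p w v := by
    rw [fderiv_clm_apply hd (by fun_prop)]
    simp
  rw [e, e]
  exact hs.eq _ _

theorem smooth_dx_iter {f : ℝ × ℝ → ℂ} (hf : ContDiff ℝ ∞ f) (β : ℕ) :
    ContDiff ℝ ∞ (dx^[β] f) := by
  induction β generalizing f with
  | zero => exact hf
  | succ n ih => exact ih (smooth_dx hf)

theorem smooth_dt_iter {f : ℝ × ℝ → ℂ} (hf : ContDiff ℝ ∞ f) (α : ℕ) :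
    ContDiff ℝ ∞ (dt^[α] f) := by
  induction α generalizing f with
  | zero => exact hf
  | succ n ih => exact ih (smooth_dt hf)

theorem smooth_mixedDeriv {f : ℝ × ℝ → ℂ} (hf : ContDiff ℝ ∞ f) (α β : ℕ) :
    ContDiff ℝ ∞ (mixedDeriv α β f) := smooth_dt_iter (smooth_dx_iter hf β) α

theorem mixedDeriv_dx (α β : ℕ) (f : ℝ × ℝ → ℂ) :
    mixedDeriv α β (dx f) = mixedDeriv α (β + 1) f := rfl

theorem dx_iter_dt {f : ℝ × ℝ → ℂ} (hf : ContDiff ℝ ∞ f) (β : ℕ) :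
    dx^[β] (dt f) = dt (dx^[β] f) := by
  induction β generalizing f with
  | zero => rfl
  | succ n ih =>
    rw [Function.iterate_succ_apply, Function.iterate_succ_apply, dx_dt hf, ih (smooth_dx hf)]

theorem mixedDeriv_dt {f : ℝ × ℝ → ℂ} (hf : ContDiff ℝ ∞ f) (α β : ℕ) :
    mixedDeriv α β (dt f) = mixedDeriv (α + 1) β f := by
  rw [mixedDeriv, mixedDeriv, dx_iter_dt hf, Function.iterate_succ_apply]

theorem dt_add {f g : ℝ × ℝ → ℂ} (hf : ContDiff ℝ ∞ f) (hg : ContDiff ℝ ∞ g) :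
    dt (f + g) = dt f + dt g := by
  have h : ContDiff ℝ ∞ (f + g) := hf.add hg
  rw [dt_eq h, dt_eq hf, dt_eq hg]
  funext p
  rw [fderiv_add (hf.differentiable (by simp) p) (hg.differentiable (by simp) p)]
  rfl

theorem dx_add {f g : ℝ × ℝ → ℂ} (hf : ContDiff ℝ ∞ f) (hg : ContDiff ℝ ∞ g) :
    dx (f + g) = dx f + dx g := by
  have h : ContDiff ℝ ∞ (f + g) := hf.add hg
  rw [dx_eq h, dx_eq hf, dx_eq hg]
  funext p
  rw [fderiv_add (hf.differentiable (by simp) p) (hg.differentiable (by simp) p)]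
  rfl

theorem dt_mul {f g : ℝ × ℝ → ℂ} (hf : ContDiff ℝ ∞ f) (hg : ContDiff ℝ ∞ g) :
    dt (f * g) = dt f * g + f * dt g := by
  have h : ContDiff ℝ ∞ (f * g) := hf.mul hg
  rw [dt_eq h, dt_eq hf, dt_eq hg]
  funext p
  rw [fderiv_mul (hf.differentiable (by simp) p) (hg.differentiable (by simp) p)]
  simp
  ring

theorem dx_mul {f g : ℝ × ℝ → ℂ} (hf : ContDiff ℝ ∞ f) (hg : ContDiff ℝ ∞ g) :
    dx (f * g) = dx f * g + f * dx g := by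
  have h : ContDiff ℝ ∞ (f * g) := hf.mul hg
  rw [dx_eq h, dx_eq hf, dx_eq hg]
  funext p
  rw [fderiv_mul (hf.differentiable (by simp) p) (hg.differentiable (by simp) p)]
  simp
  ring

theorem smooth_mul {f g : ℝ × ℝ → ℂ} (hf : ContDiff ℝ ∞ f) (hg : ContDiff ℝ ∞ g) :
    ContDiff ℝ ∞ (f * g) := hf.mul hg

theorem dt_smul (c : ℂ) (f : ℝ × ℝ → ℂ) : dt (c • f) = c • dt f := by
  funext p
  exact deriv_const_smul_field c (f := fun s => f (s, p.2))

theorem dx_smul (c : ℂ) (f : ℝ × ℝ → ℂ) : dx (c • f) = c • dx f := by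
  funext p
  exact deriv_const_smul_field c (f := fun y => f (p.1, y))

theorem mixedDeriv_add {f g : ℝ × ℝ → ℂ} (hf : ContDiff ℝ ∞ f) (hg : ContDiff ℝ ∞ g) (α β : ℕ) :
    mixedDeriv α β (f + g) = mixedDeriv α β f + mixedDeriv α β g := by
  induction β generalizing f g with
  | zero =>
    induction α generalizing f g with
    | zero => rfl
    | succ n ih =>
      have h : ContDiff ℝ ∞ (f + g) := hf.add hg
      rw [← mixedDeriv_dt h, ← mixedDeriv_dt hf, ← mixedDeriv_dt hg, dt_add hf hg,
        ih (smooth_dt hf) (smooth_dt hg)]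
  | succ n ih =>
    simp only [← mixedDeriv_dx]
    rw [dx_add hf hg, ih (smooth_dx hf) (smooth_dx hg)]

theorem mixedDeriv_smul (c : ℂ) (f : ℝ × ℝ → ℂ) (α β : ℕ) :
    mixedDeriv α β (c • f) = c • mixedDeriv α β f := by
  have h1 : ∀ g : ℝ × ℝ → ℂ, dx^[β] (c • g) = c • dx^[β] g := by
    induction β with
    | zero => intro g; rfl
    | succ n ih => intro g; simp only [Function.iterate_succ_apply, dx_smul, ih]
  have h2 : ∀ g : ℝ × ℝ → ℂ, dt^[α] (c • g) = c • dt^[α] g := by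
    induction α with
    | zero => intro g; rfl
    | succ n ih => intro g; simp only [Function.iterate_succ_apply, dt_smul, ih]
  rw [mixedDeriv, h1, h2, mixedDeriv]

theorem periodic_dt {f : ℝ × ℝ → ℂ} (hf : PeriodicT f) : PeriodicT (dt f) := by
  intro t x
  have h : (fun s => f (s, x)) = fun s => f (s + 2 * Real.pi, x) := by
    funext s; exact (hf s x).symm
  change deriv (fun s => f (s, x)) (t + 2 * Real.pi) = deriv (fun s => f (s, x)) t
  conv_rhs => rw [h]
  exact (deriv_comp_add_const (f := fun s => f (s, x)) (2 * Real.pi) t).symm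

theorem periodic_dx {f : ℝ × ℝ → ℂ} (hf : PeriodicT f) : PeriodicT (dx f) := by
  intro t x
  change deriv (fun y => f (t + 2 * Real.pi, y)) x = deriv (fun y => f (t, y)) x
  congr 1
  funext y
  exact hf t y

/-- The space `𝒮(𝕋¹ × ℝ)`: smooth functions on `𝕋¹ × ℝ` with
`sup |x^γ ∂_t^α ∂_x^β f| < ∞` for all `α, β, γ`. -/
def schwartzSubmodule : Submodule ℂ (ℝ × ℝ → ℂ) where
  carrier := {f | ContDiff ℝ ∞ f ∧ PeriodicT f ∧
    ∀ α β γ : ℕ, ∃ C : ℝ, ∀ p : ℝ × ℝ, ‖(p.2 : ℂ) ^ γ * mixedDeriv α β f p‖ ≤ C}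
  zero_mem' := by
    refine ⟨contDiff_const, fun _ _ => rfl, fun α β γ => ⟨0, fun p => ?_⟩⟩
    have h : mixedDeriv α β (0 : ℝ × ℝ → ℂ) = 0 := by
      have := mixedDeriv_smul 0 0 α β
      simpa using this
    rw [h]
    simp
  add_mem' := by
    rintro f g ⟨hf, pf, bf⟩ ⟨hg, pg, bg⟩
    refine ⟨hf.add hg, fun t x => congrArg₂ (· + ·) (pf t x) (pg t x), fun α β γ => ?_⟩
    obtain ⟨C, hC⟩ := bf α β γ
    obtain ⟨C', hC'⟩ := bg α β γ
    refine ⟨C + C', fun p => ?_⟩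
    rw [mixedDeriv_add hf hg, Pi.add_apply, mul_add]
    exact (norm_add_le _ _).trans (add_le_add (hC p) (hC' p))
  smul_mem' := by
    rintro c f ⟨hf, pf, bf⟩
    refine ⟨contDiff_const.smul hf, fun t x => congrArg (c • ·) (pf t x), fun α β γ => ?_⟩
    obtain ⟨C, hC⟩ := bf α β γ
    refine ⟨‖c‖ * C, fun p => ?_⟩
    rw [mixedDeriv_smul, Pi.smul_apply, smul_eq_mul, mul_left_comm, norm_mul]
    exact mul_le_mul_of_nonneg_left (hC p) (norm_nonneg c)

/-- The space `𝒮(𝕋¹ × ℝ)` as a type. -/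
def SchwartzTR : Type := schwartzSubmodule

namespace SchwartzTR

instance : AddCommGroup SchwartzTR := inferInstanceAs (AddCommGroup schwartzSubmodule)

instance : Module ℂ SchwartzTR := inferInstanceAs (Module ℂ schwartzSubmodule)

instance : FunLike SchwartzTR (ℝ × ℝ) ℂ where
  coe f := Subtype.val (p := fun f => f ∈ schwartzSubmodule) f
  coe_injective := Subtype.val_injective

theorem smooth (f : SchwartzTR) : ContDiff ℝ ∞ f := f.2.1

theorem periodic (f : SchwartzTR) : PeriodicT f := f.2.2.1

theorem decay (f : SchwartzTR) (α β γ : ℕ) :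
    ∃ C : ℝ, ∀ p : ℝ × ℝ, ‖(p.2 : ℂ) ^ γ * mixedDeriv α β f p‖ ≤ C := f.2.2.2 α β γ

theorem coe_add (f g : SchwartzTR) : ((f + g : SchwartzTR) : ℝ × ℝ → ℂ) = ⇑f + ⇑g := rfl

theorem coe_smul (c : ℂ) (f : SchwartzTR) : ((c • f : SchwartzTR) : ℝ × ℝ → ℂ) = c • ⇑f := rfl

/-- The seminorm `‖f‖_{α,β,γ} = sup |x^γ ∂_t^α ∂_x^β f(t,x)|`. -/
def seminorm (α β γ : ℕ) : Seminorm ℂ SchwartzTR :=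
  Seminorm.ofSMulLE (fun f => ⨆ p : ℝ × ℝ, ‖(p.2 : ℂ) ^ γ * mixedDeriv α β f p‖)
    (by
      have h : mixedDeriv α β ((0 : SchwartzTR) : ℝ × ℝ → ℂ) = 0 := by
        have := mixedDeriv_smul 0 ((0 : SchwartzTR) : ℝ × ℝ → ℂ) α β
        rw [← coe_smul] at this
        simpa using this
      simp [h])
    (by
      intro f g
      obtain ⟨C, hC⟩ := f.decay α β γ
      obtain ⟨C', hC'⟩ := g.decay α β γ
      refine ciSup_le fun p => ?_
      rw [coe_add, mixedDeriv_add f.smooth g.smooth, Pi.add_apply, mul_add]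
      refine (norm_add_le _ _).trans (add_le_add ?_ ?_)
      · exact le_ciSup (f := fun p : ℝ × ℝ => ‖(p.2 : ℂ) ^ γ * mixedDeriv α β f p‖)
          ⟨C, by rintro _ ⟨q, rfl⟩; exact hC q⟩ p
      · exact le_ciSup (f := fun p : ℝ × ℝ => ‖(p.2 : ℂ) ^ γ * mixedDeriv α β g p‖)
          ⟨C', by rintro _ ⟨q, rfl⟩; exact hC' q⟩ p)
    (by
      intro c f
      obtain ⟨C, hC⟩ := f.decay α β γ
      refine ciSup_le fun p => ?_
      rw [coe_smul, mixedDeriv_smul, Pi.smul_apply, smul_eq_mul, mul_left_comm, norm_mul]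
      refine mul_le_mul_of_nonneg_left ?_ (norm_nonneg c)
      exact le_ciSup (f := fun p : ℝ × ℝ => ‖(p.2 : ℂ) ^ γ * mixedDeriv α β f p‖)
          ⟨C, by rintro _ ⟨q, rfl⟩; exact hC q⟩ p)

theorem seminorm_apply (α β γ : ℕ) (f : SchwartzTR) :
    seminorm α β γ f = ⨆ p : ℝ × ℝ, ‖(p.2 : ℂ) ^ γ * mixedDeriv α β f p‖ := rfl

theorem le_seminorm (α β γ : ℕ) (f : SchwartzTR) (p : ℝ × ℝ) :
    ‖(p.2 : ℂ) ^ γ * mixedDeriv α β f p‖ ≤ seminorm α β γ f := by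
  obtain ⟨C, hC⟩ := f.decay α β γ
  exact le_ciSup (f := fun p : ℝ × ℝ => ‖(p.2 : ℂ) ^ γ * mixedDeriv α β f p‖)
    ⟨C, by rintro _ ⟨q, rfl⟩; exact hC q⟩ p

theorem seminorm_le (α β γ : ℕ) (f : SchwartzTR) (C : ℝ)
    (h : ∀ p : ℝ × ℝ, ‖(p.2 : ℂ) ^ γ * mixedDeriv α β f p‖ ≤ C) : seminorm α β γ f ≤ C :=
  ciSup_le h

/-- The triples `(α, β, γ)` with `α + β + γ ≤ N`. -/
def triples (N : ℕ) : Finset (ℕ × ℕ × ℕ) :=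
  (Finset.range (N + 1) ×ˢ Finset.range (N + 1) ×ˢ Finset.range (N + 1)).filter
    fun i => i.1 + i.2.1 + i.2.2 ≤ N

/-- The norms `p_N(f) = ∑_{α + β + γ ≤ N} ‖f‖_{α,β,γ}`. -/
def pN : SeminormFamily ℂ SchwartzTR ℕ :=
  fun N => ∑ i ∈ triples N, seminorm i.1 i.2.1 i.2.2

theorem pN_apply (N : ℕ) (f : SchwartzTR) :
    pN N f = ∑ i ∈ triples N, seminorm i.1 i.2.1 i.2.2 f := by
  change FunLike.coeAddMonoidHom _ _ _ (∑ i ∈ triples N, seminorm i.1 i.2.1 i.2.2) f = _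
  simp [map_sum, Finset.sum_apply]

theorem seminorm_le_pN {α β γ N : ℕ} (h : α + β + γ ≤ N) (f : SchwartzTR) :
    seminorm α β γ f ≤ pN N f := by
  rw [pN_apply]
  refine Finset.single_le_sum (f := fun i : ℕ × ℕ × ℕ => seminorm i.1 i.2.1 i.2.2 f)
    (fun i _ => apply_nonneg _ _) (a := (α, β, γ)) ?_
  simp only [triples, Finset.mem_filter, Finset.mem_product, Finset.mem_range]
  omega

theorem le_pN {α β γ N : ℕ} (h : α + β + γ ≤ N) (f : SchwartzTR) (p : ℝ × ℝ) :
    ‖(p.2 : ℂ) ^ γ * mixedDeriv α β f p‖ ≤ pN N f :=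
  (le_seminorm α β γ f p).trans (seminorm_le_pN h f)

theorem pN_mono {N M : ℕ} (h : N ≤ M) (f : SchwartzTR) : pN N f ≤ pN M f := by
  rw [pN_apply, pN_apply]
  refine Finset.sum_le_sum_of_subset_of_nonneg ?_ (fun i _ _ => apply_nonneg _ _)
  intro i hi
  simp only [triples, Finset.mem_filter, Finset.mem_product, Finset.mem_range] at hi ⊢
  omega

/-- The Fréchet topology of `𝒮(𝕋¹ × ℝ)`, induced by the countable family `p_N`. -/
instance : TopologicalSpace SchwartzTR := pN.moduleFilterBasis.topology'

theorem withSeminorms : WithSeminorms pN := ⟨rfl⟩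

instance : ContinuousSMul ℂ SchwartzTR := withSeminorms.continuousSMul

instance : IsTopologicalAddGroup SchwartzTR := withSeminorms.topologicalAddGroup

/-- A linear map is bounded if every `p_N (T f)` is bounded by a multiple of some `p_M f`. -/
def Bdd (T : SchwartzTR →ₗ[ℂ] SchwartzTR) : Prop :=
  ∀ α β γ : ℕ, ∃ (M : ℕ) (C : ℝ), ∀ f, seminorm α β γ (T f) ≤ C * pN M f

theorem Bdd.pN {T : SchwartzTR →ₗ[ℂ] SchwartzTR} (h : Bdd T) (N : ℕ) :
    ∃ (M : ℕ) (C : ℝ), 0 ≤ C ∧ ∀ f, SchwartzTR.pN N (T f) ≤ C * SchwartzTR.pN M f := by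
  choose M C hC using h
  refine ⟨∑ i ∈ triples N, M i.1 i.2.1 i.2.2, ∑ i ∈ triples N, |C i.1 i.2.1 i.2.2|,
    Finset.sum_nonneg fun _ _ => abs_nonneg _, fun f => ?_⟩
  rw [pN_apply, Finset.sum_mul]
  refine Finset.sum_le_sum fun i hi => (hC _ _ _ f).trans ?_
  have h1 : M i.1 i.2.1 i.2.2 ≤ ∑ i ∈ triples N, M i.1 i.2.1 i.2.2 :=
    Finset.single_le_sum (f := fun i : ℕ × ℕ × ℕ => M i.1 i.2.1 i.2.2)
      (fun _ _ => Nat.zero_le _) hi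
  refine (mul_le_mul_of_nonneg_right (le_abs_self _) (apply_nonneg _ _)).trans ?_
  exact mul_le_mul_of_nonneg_left (pN_mono h1 f) (abs_nonneg _)

theorem Bdd.comp {T U : SchwartzTR →ₗ[ℂ] SchwartzTR} (hT : Bdd T) (hU : Bdd U) :
    Bdd (T ∘ₗ U) := by
  intro α β γ
  obtain ⟨M, C, hC⟩ := hT α β γ
  obtain ⟨M', C', _, hC'⟩ := hU.pN M
  refine ⟨M', |C| * C', fun f => (hC (U f)).trans ?_⟩
  rw [mul_assoc]
  exact (mul_le_mul_of_nonneg_right (le_abs_self C) (apply_nonneg _ _)).trans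
    (mul_le_mul_of_nonneg_left (hC' f) (abs_nonneg _))

theorem Bdd.continuous {T : SchwartzTR →ₗ[ℂ] SchwartzTR} (hT : Bdd T) : Continuous T := by
  refine WithSeminorms.continuous_of_isBounded withSeminorms withSeminorms T fun N => ?_
  obtain ⟨M, C, h0, hC⟩ := hT.pN N
  refine ⟨{M}, ⟨C, h0⟩, fun f => ?_⟩
  simp only [Finset.sup_singleton]
  exact hC f

/-- The continuous operator given by a bounded linear map. -/
def Bdd.clm {T : SchwartzTR →ₗ[ℂ] SchwartzTR} (hT : Bdd T) : SchwartzTR →L[ℂ] SchwartzTR :=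
  ⟨T, hT.continuous⟩

end SchwartzTR

open SchwartzTR

/-- At most polynomial growth in `x`, uniformly in `t`. -/
def PolyGrowth (h : ℝ × ℝ → ℂ) : Prop :=
  ∃ (N : ℕ) (C : ℝ), 0 ≤ C ∧ ∀ p : ℝ × ℝ, ‖h p‖ ≤ C * (1 + |p.2|) ^ N

theorem PolyGrowth.add {f g : ℝ × ℝ → ℂ} (hf : PolyGrowth f) (hg : PolyGrowth g) :
    PolyGrowth (f + g) := by
  obtain ⟨N, C, h0, hC⟩ := hf
  obtain ⟨N', C', h0', hC'⟩ := hg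
  refine ⟨N + N', C + C', add_nonneg h0 h0', fun p => (norm_add_le _ _).trans ?_⟩
  have h1 : (1 : ℝ) ≤ 1 + |p.2| := by linarith [abs_nonneg p.2]
  rw [add_mul]
  refine add_le_add ((hC p).trans ?_) ((hC' p).trans ?_)
  · exact mul_le_mul_of_nonneg_left (pow_le_pow_right₀ h1 (Nat.le_add_right _ _)) h0
  · exact mul_le_mul_of_nonneg_left (pow_le_pow_right₀ h1 (Nat.le_add_left _ _)) h0'

theorem PolyGrowth.mul {f g : ℝ × ℝ → ℂ} (hf : PolyGrowth f) (hg : PolyGrowth g) :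
    PolyGrowth (f * g) := by
  obtain ⟨N, C, h0, hC⟩ := hf
  obtain ⟨N', C', h0', hC'⟩ := hg
  refine ⟨N + N', C * C', mul_nonneg h0 h0', fun p => ?_⟩
  rw [Pi.mul_apply, norm_mul, pow_add, mul_mul_mul_comm]
  exact mul_le_mul (hC p) (hC' p) (norm_nonneg _) ((norm_nonneg _).trans (hC p))

/-- Multipliers of `𝒮(𝕋¹ × ℝ)`: smooth functions on `𝕋¹ × ℝ` that grow at most polynomially
in `x`, uniformly in `t`, along with all of their derivatives. -/
structure IsMultiplier (m : ℝ × ℝ → ℂ) : Prop where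
  smooth : ContDiff ℝ ∞ m
  periodic : PeriodicT m
  growth : ∀ α β : ℕ, PolyGrowth (mixedDeriv α β m)

namespace IsMultiplier

variable {m n : ℝ × ℝ → ℂ}

theorem dt (hm : IsMultiplier m) : IsMultiplier (dt m) where
  smooth := smooth_dt hm.smooth
  periodic := periodic_dt hm.periodic
  growth α β := by rw [mixedDeriv_dt hm.smooth]; exact hm.growth _ _

theorem dx (hm : IsMultiplier m) : IsMultiplier (dx m) where
  smooth := smooth_dx hm.smooth
  periodic := periodic_dx hm.periodic
  growth α β := hm.growth α (β + 1)

theorem add (hm : IsMultiplier m) (hn : IsMultiplier n) : IsMultiplier (m + n) where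
  smooth := hm.smooth.add hn.smooth
  periodic t x := congrArg₂ (· + ·) (hm.periodic t x) (hn.periodic t x)
  growth α β := by
    rw [mixedDeriv_add hm.smooth hn.smooth]; exact (hm.growth α β).add (hn.growth α β)

theorem mul (hm : IsMultiplier m) (hn : IsMultiplier n) : IsMultiplier (m * n) where
  smooth := hm.smooth.mul hn.smooth
  periodic t x := congrArg₂ (· * ·) (hm.periodic t x) (hn.periodic t x)
  growth α β := by
    induction β generalizing m n with
    | zero =>
      induction α generalizing m n with
      | zero => exact (hm.growth 0 0).mul (hn.growth 0 0)
      | succ k ih =>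
        have h : ContDiff ℝ ∞ (m * n) := hm.smooth.mul hn.smooth
        rw [← mixedDeriv_dt h, dt_mul hm.smooth hn.smooth,
          mixedDeriv_add (smooth_mul hm.dt.smooth hn.smooth) (smooth_mul hm.smooth hn.dt.smooth)]
        exact (ih hm.dt hn).add (ih hm hn.dt)
    | succ k ih =>
      rw [← mixedDeriv_dx, dx_mul hm.smooth hn.smooth,
        mixedDeriv_add (smooth_mul hm.dx.smooth hn.smooth) (smooth_mul hm.smooth hn.dx.smooth)]
      exact (ih hm.dx hn).add (ih hm hn.dx)

theorem of_deriv (hs : ContDiff ℝ ∞ m) (hp : PeriodicT m) (h0 : PolyGrowth m)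
    (ht : IsMultiplier (TorusLine.dt m)) (hx : IsMultiplier (TorusLine.dx m)) :
    IsMultiplier m where
  smooth := hs
  periodic := hp
  growth α β := by
    cases β with
    | zero =>
      cases α with
      | zero => exact h0
      | succ k => rw [← mixedDeriv_dt hs]; exact ht.growth k 0
    | succ k => exact hx.growth α k

theorem zero : IsMultiplier 0 := by
  refine ⟨contDiff_const, fun _ _ => rfl, fun α β => ⟨0, 0, le_rfl, fun p => ?_⟩⟩
  have h : mixedDeriv α β (0 : ℝ × ℝ → ℂ) = 0 := by
    have := mixedDeriv_smul 0 0 α β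
    simpa using this
  simp [h]

theorem const (c : ℂ) : IsMultiplier (fun _ => c) := by
  have h1 : TorusLine.dt (fun _ => c) = 0 := by funext p; simp [TorusLine.dt]
  have h2 : TorusLine.dx (fun _ => c) = 0 := by funext p; simp [TorusLine.dx]
  refine of_deriv contDiff_const (fun _ _ => rfl) ⟨0, ‖c‖, norm_nonneg c, by simp⟩ ?_ ?_
  · rw [h1]; exact zero
  · rw [h2]; exact zero

theorem coordX : IsMultiplier (fun p => (p.2 : ℂ)) := by
  have h1 : TorusLine.dt (fun p => (p.2 : ℂ)) = 0 := by funext p; simp [TorusLine.dt]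
  have h2 : TorusLine.dx (fun p => (p.2 : ℂ)) = fun _ => 1 := by
    funext p
    exact (Complex.ofRealCLM.hasDerivAt (x := p.2)).deriv
  refine of_deriv (Complex.ofRealCLM.contDiff.comp contDiff_snd) (fun _ _ => rfl)
    ⟨1, 1, zero_le_one, fun p => ?_⟩ ?_ ?_
  · simp
  · rw [h1]; exact zero
  · rw [h2]; exact const 1

/-- If `∂_t e = a e`, `∂_x e = b e` with multipliers `a, b`, then `e` is a multiplier. -/
theorem of_ode {e a b : ℝ × ℝ → ℂ} (hs : ContDiff ℝ ∞ e) (hp : PeriodicT e) (h0 : PolyGrowth e)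
    (ha : IsMultiplier a) (hb : IsMultiplier b)
    (ht : TorusLine.dt e = a * e) (hx : TorusLine.dx e = b * e) : IsMultiplier e := by
  have key : ∀ α β : ℕ, ∀ k, IsMultiplier k → PolyGrowth (mixedDeriv α β (k * e)) := by
    intro α β
    induction β with
    | zero =>
      induction α with
      | zero => intro k hk; exact (hk.growth 0 0).mul h0
      | succ j ih =>
        intro k hk
        have h : ContDiff ℝ ∞ (k * e) := hk.smooth.mul hs
        have e1 : TorusLine.dt k * e + k * (a * e) = (TorusLine.dt k + k * a) * e := by ring
        rw [← mixedDeriv_dt h, dt_mul hk.smooth hs, ht, e1]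
        exact ih _ (hk.dt.add (hk.mul ha))
    | succ j ih =>
      intro k hk
      have e1 : TorusLine.dx k * e + k * (b * e) = (TorusLine.dx k + k * b) * e := by ring
      rw [← mixedDeriv_dx, dx_mul hk.smooth hs, hx, e1]
      exact ih _ (hk.dx.add (hk.mul hb))
  refine ⟨hs, hp, fun α β => ?_⟩
  have := key α β _ (const 1)
  rwa [show (fun _ => (1 : ℂ)) * e = e by funext p; simp] at this

/-- `e^{iφ}` is a multiplier for every real valued multiplier `φ`. -/
theorem exp_I {φ : ℝ × ℝ → ℝ} (hφ : IsMultiplier (fun p => (φ p : ℂ))) :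
    IsMultiplier (fun p => Complex.exp (Complex.I * φ p)) := by
  have hd := hφ.smooth.differentiable (by simp)
  have hs : ContDiff ℝ ∞ (fun p => Complex.exp (Complex.I * φ p)) :=
    (contDiff_const.mul hφ.smooth).cexp
  refine of_ode (a := (fun _ => Complex.I) * TorusLine.dt (fun p => (φ p : ℂ)))
    (b := (fun _ => Complex.I) * TorusLine.dx (fun p => (φ p : ℂ))) hs (fun t x => ?_)
    ⟨0, 1, zero_le_one, fun p => ?_⟩ ((const _).mul hφ.dt) ((const _).mul hφ.dx) ?_ ?_
  · exact congrArg (fun z => Complex.exp (Complex.I * z)) (hφ.periodic t x)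
  · change ‖Complex.exp (Complex.I * φ p)‖ ≤ _
    rw [mul_comm, Complex.norm_exp_ofReal_mul_I]; simp
  · rw [dt_eq hs, dt_eq hφ.smooth]
    funext p
    rw [(((hd p).hasFDerivAt.const_mul Complex.I).cexp).fderiv]
    simp [mul_comm]
  · rw [dx_eq hs, dx_eq hφ.smooth]
    funext p
    rw [(((hd p).hasFDerivAt.const_mul Complex.I).cexp).fderiv]
    simp [mul_comm]

end IsMultiplier

/-- The operator `∂_t` on `𝒮(𝕋¹ × ℝ)`, as a linear map. -/
def dtLM : SchwartzTR →ₗ[ℂ] SchwartzTR where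
  toFun f := ⟨dt f, smooth_dt f.smooth, periodic_dt f.periodic, fun α β γ => by
    rw [mixedDeriv_dt f.smooth]; exact f.decay _ _ _⟩
  map_add' f g := Subtype.ext (dt_add f.smooth g.smooth)
  map_smul' c f := Subtype.ext (dt_smul c ⇑f)

/-- The operator `∂_x` on `𝒮(𝕋¹ × ℝ)`, as a linear map. -/
def dxLM : SchwartzTR →ₗ[ℂ] SchwartzTR where
  toFun f := ⟨dx f, smooth_dx f.smooth, periodic_dx f.periodic, fun α β γ => f.decay α (β + 1) γ⟩
  map_add' f g := Subtype.ext (dx_add f.smooth g.smooth)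
  map_smul' c f := Subtype.ext (dx_smul c ⇑f)

theorem dtLM_coe (f : SchwartzTR) : (dtLM f : ℝ × ℝ → ℂ) = dt f := rfl

theorem dxLM_coe (f : SchwartzTR) : (dxLM f : ℝ × ℝ → ℂ) = dx f := rfl

theorem dtLM_bdd : Bdd dtLM := fun α β γ => ⟨α + 1 + β + γ, 1, fun f => by
  rw [one_mul]
  refine seminorm_le _ _ _ _ _ fun p => ?_
  rw [dtLM_coe, mixedDeriv_dt f.smooth]
  exact le_pN le_rfl f p⟩

theorem dxLM_bdd : Bdd dxLM := fun α β γ => ⟨α + (β + 1) + γ, 1, fun f => by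
  rw [one_mul]
  refine seminorm_le _ _ _ _ _ fun p => ?_
  rw [dxLM_coe, mixedDeriv_dx]
  exact le_pN le_rfl f p⟩

/-- `∂_t : 𝒮(𝕋¹ × ℝ) → 𝒮(𝕋¹ × ℝ)`. -/
def dtCLM : SchwartzTR →L[ℂ] SchwartzTR := dtLM_bdd.clm

/-- `∂_x : 𝒮(𝕋¹ × ℝ) → 𝒮(𝕋¹ × ℝ)`. -/
def dxCLM : SchwartzTR →L[ℂ] SchwartzTR := dxLM_bdd.clm

theorem mul_bound (α β γ : ℕ) {m : ℝ × ℝ → ℂ} (hm : IsMultiplier m) :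
    ∃ (M : ℕ) (C : ℝ), 0 ≤ C ∧ ∀ (f : SchwartzTR) (p : ℝ × ℝ),
      ‖(p.2 : ℂ) ^ γ * mixedDeriv α β (m * ⇑f) p‖ ≤ C * pN M f := by
  induction β generalizing m with
  | zero =>
    induction α generalizing m with
    | zero =>
      obtain ⟨N, C, h0, hC⟩ := hm.growth 0 0
      refine ⟨γ + N, C * (2 ^ (N - 1) * 2), by positivity, fun f p => ?_⟩
      have h1 : ‖m p‖ ≤ C * (1 + |p.2|) ^ N := hC p
      have h2 : (1 + |p.2|) ^ N ≤ 2 ^ (N - 1) * (1 ^ N + |p.2| ^ N) :=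
        add_pow_le zero_le_one (abs_nonneg _) N
      have h3 := le_pN (α := 0) (β := 0) (γ := γ) (N := γ + N) (by omega) f p
      have h4 := le_pN (α := 0) (β := 0) (γ := γ + N) (N := γ + N) (by omega) f p
      simp only [mixedDeriv, Function.iterate_zero, id, norm_mul, norm_pow, Complex.norm_real,
        Real.norm_eq_abs, Pi.mul_apply, pow_add] at h3 h4 ⊢
      calc |p.2| ^ γ * (‖m p‖ * ‖f p‖)
          ≤ |p.2| ^ γ * ((C * (2 ^ (N - 1) * (1 ^ N + |p.2| ^ N))) * ‖f p‖) := by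
            have := h1.trans (mul_le_mul_of_nonneg_left h2 h0)
            gcongr
        _ = C * 2 ^ (N - 1) * (|p.2| ^ γ * ‖f p‖ + |p.2| ^ γ * |p.2| ^ N * ‖f p‖) := by
            rw [one_pow]; ring
        _ ≤ C * 2 ^ (N - 1) * (pN (γ + N) f + pN (γ + N) f) := by gcongr
        _ = _ := by ring
    | succ k ih =>
      obtain ⟨M, C, h0, hC⟩ := ih hm.dt
      obtain ⟨M', C', h0', hC'⟩ := ih hm
      obtain ⟨M2, C2, h02, hC2⟩ := dtLM_bdd.pN M'
      refine ⟨M + M2, C + C' * C2, by positivity, fun f p => ?_⟩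
      have h : ContDiff ℝ ∞ (m * ⇑f) := hm.smooth.mul f.smooth
      rw [← mixedDeriv_dt h, dt_mul hm.smooth f.smooth,
        mixedDeriv_add (smooth_mul hm.dt.smooth f.smooth) (smooth_mul hm.smooth (smooth_dt f.smooth)),
        Pi.add_apply, mul_add, add_mul, mul_assoc]
      refine (norm_add_le _ _).trans (add_le_add ((hC f p).trans ?_) ((hC' (dtLM f) p).trans ?_))
      · exact mul_le_mul_of_nonneg_left (pN_mono (by omega) f) h0
      · refine mul_le_mul_of_nonneg_left ((hC2 f).trans ?_) h0'
        exact mul_le_mul_of_nonneg_left (pN_mono (by omega) f) h02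
  | succ k ih =>
    obtain ⟨M, C, h0, hC⟩ := ih hm.dx
    obtain ⟨M', C', h0', hC'⟩ := ih hm
    obtain ⟨M2, C2, h02, hC2⟩ := dxLM_bdd.pN M'
    refine ⟨M + M2, C + C' * C2, by positivity, fun f p => ?_⟩
    rw [← mixedDeriv_dx, dx_mul hm.smooth f.smooth,
      mixedDeriv_add (smooth_mul hm.dx.smooth f.smooth) (smooth_mul hm.smooth (smooth_dx f.smooth)),
      Pi.add_apply, mul_add, add_mul, mul_assoc]
    refine (norm_add_le _ _).trans (add_le_add ((hC f p).trans ?_) ((hC' (dxLM f) p).trans ?_))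
    · exact mul_le_mul_of_nonneg_left (pN_mono (by omega) f) h0
    · refine mul_le_mul_of_nonneg_left ((hC2 f).trans ?_) h0'
      exact mul_le_mul_of_nonneg_left (pN_mono (by omega) f) h02

/-- Multiplication by a multiplier, as a linear map. -/
def mulLM {m : ℝ × ℝ → ℂ} (hm : IsMultiplier m) : SchwartzTR →ₗ[ℂ] SchwartzTR where
  toFun f := ⟨m * ⇑f, hm.smooth.mul f.smooth,
    fun t x => congrArg₂ (· * ·) (hm.periodic t x) (f.periodic t x),
    fun α β γ => by
      obtain ⟨M, C, _, hC⟩ := mul_bound α β γ hm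
      exact ⟨_, hC f⟩⟩
  map_add' f g := Subtype.ext (mul_add m ⇑f ⇑g)
  map_smul' c f := Subtype.ext (mul_smul_comm c m ⇑f)

theorem mulLM_bdd {m : ℝ × ℝ → ℂ} (hm : IsMultiplier m) : Bdd (mulLM hm) := fun α β γ => by
  obtain ⟨M, C, _, hC⟩ := mul_bound α β γ hm
  exact ⟨M, C, fun f => seminorm_le _ _ _ _ _ (hC f)⟩

/-- Multiplication by a multiplier, `f ↦ m f` on `𝒮(𝕋¹ × ℝ)`. -/
def mulCLM {m : ℝ × ℝ → ℂ} (hm : IsMultiplier m) : SchwartzTR →L[ℂ] SchwartzTR :=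
  (mulLM_bdd hm).clm

theorem mulCLM_apply {m : ℝ × ℝ → ℂ} (hm : IsMultiplier m) (f : SchwartzTR) (p : ℝ × ℝ) :
    mulCLM hm f p = m p * f p := rfl

theorem norm_le_inv (f : SchwartzTR) (p : ℝ × ℝ) :
    ‖f p‖ ≤ 2 * pN 2 f * (1 + p.2 ^ 2)⁻¹ := by
  have h1 := le_pN (α := 0) (β := 0) (γ := 0) (N := 2) (by omega) f p
  have h2 := le_pN (α := 0) (β := 0) (γ := 2) (N := 2) (by omega) f p
  simp only [mixedDeriv, Function.iterate_zero, id, norm_mul, norm_pow, Complex.norm_real,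
    Real.norm_eq_abs, pow_zero, one_mul, sq_abs] at h1 h2
  rw [← div_eq_mul_inv, le_div_iff₀ (by positivity)]
  linarith

theorem integrable_slice (f : SchwartzTR) (t : ℝ) : Integrable (fun x => f (t, x)) := by
  refine (integrable_inv_one_add_sq.const_mul (2 * pN 2 f)).mono' ?_
    (Filter.Eventually.of_forall fun x => norm_le_inv f (t, x))
  exact (f.smooth.continuous.comp (by fun_prop : Continuous fun x : ℝ => (t, x))).aestronglyMeasurable

/-- The oscillatory integral `∫ e^{i s x ξ} f(t, x) dx`. -/
def osc (s : ℝ) (f : ℝ × ℝ → ℂ) (p : ℝ × ℝ) : ℂ :=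
  ∫ x : ℝ, Complex.exp (((s * x * p.2 : ℝ) : ℂ) * Complex.I) * f (p.1, x)

theorem integrable_osc (s : ℝ) (f : SchwartzTR) (p : ℝ × ℝ) :
    Integrable (fun x : ℝ => Complex.exp (((s * x * p.2 : ℝ) : ℂ) * Complex.I) * f (p.1, x)) := by
  refine (integrable_slice f p.1).bdd_mul (c := 1) ?_ ?_
  · exact Continuous.aestronglyMeasurable (by fun_prop)
  · exact Filter.Eventually.of_forall fun x => by rw [Complex.norm_exp_ofReal_mul_I]

theorem norm_osc_le (s : ℝ) (f : SchwartzTR) (p : ℝ × ℝ) :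
    ‖osc s f p‖ ≤ 2 * Real.pi * pN 2 f := by
  have h := norm_integral_le_of_norm_le (μ := volume)
    (f := fun x : ℝ => Complex.exp (((s * x * p.2 : ℝ) : ℂ) * Complex.I) * f (p.1, x))
    (integrable_inv_one_add_sq.const_mul (2 * pN 2 f))
    (Filter.Eventually.of_forall fun x => by
      rw [norm_mul, Complex.norm_exp_ofReal_mul_I, one_mul]
      exact norm_le_inv f (p.1, x))
  rw [integral_const_mul, integral_univ_inv_one_add_sq] at h
  calc _ ≤ _ := h
    _ = _ := by ring

theorem osc_add (s : ℝ) (f g : SchwartzTR) : osc s (⇑f + ⇑g) = osc s f + osc s g := by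
  funext p
  rw [Pi.add_apply, osc, osc, osc, ← integral_add (integrable_osc s f p) (integrable_osc s g p)]
  simp only [Pi.add_apply, mul_add]

theorem osc_smul (s : ℝ) (c : ℂ) (f : ℝ × ℝ → ℂ) : osc s (c • f) = c • osc s f := by
  funext p
  rw [Pi.smul_apply, osc, osc, smul_eq_mul, ← integral_const_mul]
  simp only [Pi.smul_apply, smul_eq_mul, mul_left_comm]

/-- Multiplication by `i s x`. -/
def sxLM (s : ℝ) : SchwartzTR →ₗ[ℂ] SchwartzTR :=
  (s * Complex.I) • mulLM IsMultiplier.coordX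

theorem sxLM_apply (s : ℝ) (f : SchwartzTR) (p : ℝ × ℝ) :
    sxLM s f p = s * Complex.I * (p.2 * f p) := rfl

theorem bdd_smul {T : SchwartzTR →ₗ[ℂ] SchwartzTR} (hT : Bdd T) (c : ℂ) : Bdd (c • T) := by
  intro α β γ
  obtain ⟨M, C, hC⟩ := hT α β γ
  refine ⟨M, ‖c‖ * C, fun f => ?_⟩
  rw [LinearMap.smul_apply, map_smul_eq_mul, mul_assoc]
  exact mul_le_mul_of_nonneg_left (hC f) (norm_nonneg c)

theorem sxLM_bdd (s : ℝ) : Bdd (sxLM s) := bdd_smul (mulLM_bdd _) _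

theorem hasFDerivAt_osc (s : ℝ) (f : SchwartzTR) (p : ℝ × ℝ) :
    HasFDerivAt (osc s f)
      ((ContinuousLinearMap.fst ℝ ℝ ℝ).smulRight (osc s (dtLM f) p) +
        (ContinuousLinearMap.snd ℝ ℝ ℝ).smulRight (osc s (sxLM s f) p)) p := by
  let e : ℝ × ℝ → ℝ → ℂ := fun q x => Complex.exp (((s * x * q.2 : ℝ) : ℂ) * Complex.I)
  let T1 : ℂ →L[ℝ] (ℝ × ℝ →L[ℝ] ℂ) :=
    ContinuousLinearMap.smulRightL ℝ (ℝ × ℝ) ℂ (ContinuousLinearMap.fst ℝ ℝ ℝ)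
  let T2 : ℂ →L[ℝ] (ℝ × ℝ →L[ℝ] ℂ) :=
    ContinuousLinearMap.smulRightL ℝ (ℝ × ℝ) ℂ (ContinuousLinearMap.snd ℝ ℝ ℝ)
  let F' : ℝ × ℝ → ℝ → (ℝ × ℝ →L[ℝ] ℂ) := fun q x =>
    T1 (e q x * dtLM f (q.1, x)) + T2 (e q x * sxLM s f (q.1, x))
  have i1 := integrable_osc s (dtLM f) p
  have i2 := integrable_osc s (sxLM s f) p
  have hint : (∫ x, F' p x) = (ContinuousLinearMap.fst ℝ ℝ ℝ).smulRight (osc s (dtLM f) p) +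
        (ContinuousLinearMap.snd ℝ ℝ ℝ).smulRight (osc s (sxLM s f) p) := by
    rw [integral_add (T1.integrable_comp i1) (T2.integrable_comp i2),
      T1.integral_comp_comm i1, T2.integral_comp_comm i2]
    rfl
  rw [← hint]
  have hne (q : ℝ × ℝ) (x : ℝ) : ‖e q x‖ = 1 := Complex.norm_exp_ofReal_mul_I _
  refine hasFDerivAt_integral_of_dominated_of_fderiv_le (𝕜 := ℝ) (s := Set.univ)
    (F := fun q x => e q x * f (q.1, x))
    (bound := fun x => (‖T1‖ * (2 * pN 2 (dtLM f)) + ‖T2‖ * (2 * pN 2 (sxLM s f))) *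
      (1 + x ^ 2)⁻¹) Filter.univ_mem ?_ (integrable_osc s f p) ?_ ?_
    (integrable_inv_one_add_sq.const_mul _) ?_
  · exact Filter.Eventually.of_forall fun q => (integrable_osc s f q).aestronglyMeasurable
  · exact ((T1.integrable_comp i1).add (T2.integrable_comp i2)).aestronglyMeasurable
  · refine Filter.Eventually.of_forall fun x q _ => ?_
    refine (norm_add_le _ _).trans ?_
    rw [add_mul]
    refine add_le_add ((T1.le_opNorm _).trans ?_) ((T2.le_opNorm _).trans ?_)
    · rw [norm_mul, hne, one_mul, mul_assoc]
      exact mul_le_mul_of_nonneg_left (norm_le_inv (dtLM f) (q.1, x)) (norm_nonneg _)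
    · rw [norm_mul, hne, one_mul, mul_assoc]
      exact mul_le_mul_of_nonneg_left (norm_le_inv (sxLM s f) (q.1, x)) (norm_nonneg _)
  · refine Filter.Eventually.of_forall fun x q _ => ?_
    have h1 : HasFDerivAt (fun r : ℝ × ℝ => ((s * x * r.2 : ℝ) : ℂ) * Complex.I)
        (T2 (s * x * Complex.I)) q := by
      have a1 : HasFDerivAt (fun r : ℝ × ℝ => r.2) (ContinuousLinearMap.snd ℝ ℝ ℝ) q :=
        hasFDerivAt_snd
      have a2 := (Complex.ofRealCLM.hasFDerivAt.comp q (a1.const_mul (s * x))).mul_const Complex.I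
      refine a2.congr_fderiv (ContinuousLinearMap.ext fun v => ?_)
      simp [T2]
      ring
    have h2 : HasFDerivAt (fun r : ℝ × ℝ => f (r.1, x)) (T1 (dtLM f (q.1, x))) q := by
      have b1 : HasFDerivAt f (fderiv ℝ f (q.1, x)) (q.1, x) :=
        (f.smooth.differentiable (by simp) _).hasFDerivAt
      have b2 : HasFDerivAt (fun r : ℝ × ℝ => (r.1, x))
          ((ContinuousLinearMap.fst ℝ ℝ ℝ).prod 0) q :=
        hasFDerivAt_fst.prodMk (hasFDerivAt_const x q)
      refine (b1.comp q b2).congr_fderiv (ContinuousLinearMap.ext fun v => ?_)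
      simp [T1, dtLM_coe, fderiv_eq f.smooth]
    refine (h1.cexp.mul h2).congr_fderiv (ContinuousLinearMap.ext fun v => ?_)
    simp [F', T1, T2, e, sxLM_apply]
    ring

theorem smooth_osc (s : ℝ) (f : SchwartzTR) : ContDiff ℝ ∞ (osc s f) := by
  rw [contDiff_infty]
  intro n
  induction n generalizing f with
  | zero =>
    have h : Differentiable ℝ (osc s f) := fun p => (hasFDerivAt_osc s f p).differentiableAt
    exact contDiff_zero.2 h.continuous
  | succ n ih =>
    refine contDiff_succ_iff_hasFDerivAt.2 ⟨_, ?_, hasFDerivAt_osc s f⟩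
    exact (contDiff_const.smulRight (ih _)).add (contDiff_const.smulRight (ih _))

theorem dt_osc (s : ℝ) (f : SchwartzTR) : dt (osc s f) = osc s (dtLM f) := by
  rw [dt_eq (smooth_osc s f)]
  funext p
  rw [(hasFDerivAt_osc s f p).fderiv]
  simp

theorem dx_osc (s : ℝ) (f : SchwartzTR) : dx (osc s f) = osc s (sxLM s f) := by
  rw [dx_eq (smooth_osc s f)]
  funext p
  rw [(hasFDerivAt_osc s f p).fderiv]
  simp

theorem periodic_osc (s : ℝ) {f : ℝ × ℝ → ℂ} (hf : PeriodicT f) : PeriodicT (osc s f) := by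
  intro t x
  simp only [osc]
  congr 1
  funext y
  rw [hf]

/-- Integration by parts. -/
theorem mul_osc (s : ℝ) (f : SchwartzTR) (p : ℝ × ℝ) :
    s * Complex.I * p.2 * osc s f p = - osc s (dxLM f) p := by
  let e : ℝ → ℂ := fun x => Complex.exp (((s * x * p.2 : ℝ) : ℂ) * Complex.I)
  have he (x : ℝ) : HasDerivAt e (s * Complex.I * p.2 * e x) x := by
    have h1 : HasDerivAt (fun y : ℝ => (((s * y * p.2 : ℝ) : ℂ) * Complex.I))
        (s * Complex.I * p.2) x := by
      have := (((hasDerivAt_id x).const_mul s).mul_const p.2).ofReal_comp.mul_const Complex.I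
      refine this.congr_deriv ?_
      push_cast
      ring
    refine h1.cexp.congr_deriv ?_
    simp only [e]
    ring
  have hf (x : ℝ) : HasDerivAt (fun y => f (p.1, y)) (dxLM f (p.1, x)) x := by
    have h : DifferentiableAt ℝ (fun y => f (p.1, y)) x :=
      (f.smooth.differentiable (by simp) (p.1, x)).comp x (by fun_prop)
    exact h.hasDerivAt
  have h := integral_mul_deriv_eq_deriv_mul_of_integrable (u := e) (v := fun y => f (p.1, y))
    (fun x _ => he x) (fun x _ => hf x) (integrable_osc s (dxLM f) p)
    (by
      have := (integrable_osc s f p).const_mul (s * Complex.I * p.2)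
      refine this.congr (Filter.Eventually.of_forall fun x => ?_)
      simp only [e, Pi.mul_apply]
      ring)
    (integrable_osc s f p)
  have h' : osc s (dxLM f) p = ∫ x, e x * dxLM f (p.1, x) := rfl
  rw [h', h, neg_neg, osc, ← integral_const_mul]
  congr 1
  funext x
  simp only [e]
  ring

theorem osc_bound (α β γ : ℕ) {s : ℝ} (hs : s ≠ 0) :
    ∃ (M : ℕ) (C : ℝ), 0 ≤ C ∧ ∀ (f : SchwartzTR) (p : ℝ × ℝ),
      ‖(p.2 : ℂ) ^ γ * mixedDeriv α β (osc s f) p‖ ≤ C * pN M f := by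
  have step : ∀ (T : SchwartzTR →ₗ[ℂ] SchwartzTR) (c : ℝ) (H K : SchwartzTR → ℝ × ℝ → ℂ),
      0 ≤ c → Bdd T → (∀ f p, ‖K f p‖ ≤ c * ‖H (T f) p‖) →
      (∃ (M : ℕ) (C : ℝ), 0 ≤ C ∧ ∀ f p, ‖H f p‖ ≤ C * pN M f) →
      ∃ (M : ℕ) (C : ℝ), 0 ≤ C ∧ ∀ f p, ‖K f p‖ ≤ C * pN M f := by
    rintro T c H K hc hT hK ⟨M, C, h0, hC⟩
    obtain ⟨M', C', h0', hC'⟩ := hT.pN M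
    refine ⟨M', c * (C * C'), by positivity, fun f p => (hK f p).trans ?_⟩
    rw [mul_assoc, mul_assoc]
    refine mul_le_mul_of_nonneg_left ((hC _ p).trans ?_) hc
    exact mul_le_mul_of_nonneg_left (hC' f) h0
  induction β with
  | zero =>
    induction α with
    | zero =>
      induction γ with
      | zero =>
        exact ⟨2, 2 * Real.pi, by positivity, fun f p => by
          simpa [mixedDeriv] using norm_osc_le s f p⟩
      | succ k ih =>
        refine step dxLM |s|⁻¹ _ _ (by positivity) dxLM_bdd (fun f p => ?_) ih
        have h := congrArg norm (mul_osc s f p)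
        simp only [norm_mul, norm_neg, Complex.norm_real, Complex.norm_I, mul_one,
          Real.norm_eq_abs] at h
        simp only [mixedDeriv, Function.iterate_zero, id, norm_mul, norm_pow, Complex.norm_real,
          Real.norm_eq_abs, pow_succ]
        rw [← h]
        have : |s| ≠ 0 := abs_ne_zero.2 hs
        apply le_of_eq
        field_simp
    | succ k ih =>
      refine step dtLM 1 _ _ zero_le_one dtLM_bdd (fun f p => ?_) ih
      rw [← dt_osc, mixedDeriv_dt (smooth_osc s f), one_mul]
  | succ k ih =>
    refine step (sxLM s) 1 _ _ zero_le_one (sxLM_bdd s) (fun f p => ?_) ih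
    rw [← dx_osc, mixedDeriv_dx, one_mul]

/-- The oscillatory integral as a linear map of `𝒮(𝕋¹ × ℝ)`. -/
def oscLM {s : ℝ} (hs : s ≠ 0) : SchwartzTR →ₗ[ℂ] SchwartzTR where
  toFun f := ⟨osc s f, smooth_osc s f, periodic_osc s f.periodic, fun α β γ => by
    obtain ⟨M, C, _, hC⟩ := osc_bound α β γ hs
    exact ⟨_, hC f⟩⟩
  map_add' f g := Subtype.ext (osc_add s f g)
  map_smul' c f := Subtype.ext (osc_smul s c f)

theorem oscLM_bdd {s : ℝ} (hs : s ≠ 0) : Bdd (oscLM hs) := fun α β γ => by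
  obtain ⟨M, C, _, hC⟩ := osc_bound α β γ hs
  exact ⟨M, C, fun f => seminorm_le _ _ _ _ _ (hC f)⟩

/-- The partial Fourier transform `f ↦ ∫ f(t, x) e^{-i x ξ} dx` on `𝒮(𝕋¹ × ℝ)`. -/
def fourierX : SchwartzTR →L[ℂ] SchwartzTR := (oscLM_bdd (s := -1) (by norm_num)).clm

/-- The inverse partial Fourier transform `g ↦ (2π)⁻¹ ∫ g(t, ξ) e^{i x ξ} dξ`
on `𝒮(𝕋¹ × ℝ)`. -/
def fourierXInv : SchwartzTR →L[ℂ] SchwartzTR :=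
  (2 * Real.pi : ℂ)⁻¹ • (oscLM_bdd (s := 1) one_ne_zero).clm

theorem fourierX_apply (f : SchwartzTR) (t ξ : ℝ) :
    fourierX f (t, ξ) = ∫ x : ℝ, f (t, x) * Complex.exp (-Complex.I * x * ξ) := by
  change osc (-1) f (t, ξ) = _
  unfold osc
  congr 1
  funext x
  rw [mul_comm]
  congr 2
  push_cast
  ring

theorem fourierXInv_apply (g : SchwartzTR) (t x : ℝ) :
    fourierXInv g (t, x) =
      (2 * Real.pi : ℂ)⁻¹ * ∫ ξ : ℝ, g (t, ξ) * Complex.exp (Complex.I * x * ξ) := by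
  change (2 * Real.pi : ℂ)⁻¹ * osc 1 g (t, x) = _
  unfold osc
  congr 2
  funext ξ
  rw [mul_comm]
  congr 2
  push_cast
  ring

/-- The space `C^∞(𝕋¹; E)`: smooth `2π`-periodic functions. -/
structure SmoothTorus (E : Type) [NormedAddCommGroup E] [NormedSpace ℝ E] where
  toFun : ℝ → E
  smooth : ContDiff ℝ ∞ toFun
  periodic : ∀ t, toFun (t + 2 * Real.pi) = toFun t

namespace SmoothTorus

variable {E : Type} [NormedAddCommGroup E] [NormedSpace ℝ E]

instance : CoeFun (SmoothTorus E) (fun _ => ℝ → E) := ⟨SmoothTorus.toFun⟩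

/-- The constant function `c`. -/
def const (c : E) : SmoothTorus E := ⟨fun _ => c, contDiff_const, fun _ => rfl⟩

/-- A real valued function, seen as a complex valued one. -/
def ofReal (g : SmoothTorus ℝ) : SmoothTorus ℂ :=
  ⟨fun t => (g t : ℂ), Complex.ofRealCLM.contDiff.comp g.smooth,
    fun t => congrArg Complex.ofReal (g.periodic t)⟩

/-- The average `(2π)⁻¹ ∫_0^{2π} g(t) dt`. -/
def avg (g : SmoothTorus E) : E := (2 * Real.pi)⁻¹ • ∫ t in (0 : ℝ)..(2 * Real.pi), g t

/-- The function `t ↦ ∫_0^t g(s) ds - t g_0`, where `g_0` is the average of `g`. -/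
def primitive [CompleteSpace E] (g : SmoothTorus E) : SmoothTorus E where
  toFun t := (∫ s in (0 : ℝ)..t, g s) - t • g.avg
  smooth := by
    have h : ∀ t, HasDerivAt (fun t => ∫ s in (0 : ℝ)..t, g s) (g t) t := fun t =>
      intervalIntegral.integral_hasDerivAt_right
        (g.smooth.continuous.intervalIntegrable _ _)
        g.smooth.continuous.aestronglyMeasurable.stronglyMeasurableAtFilter
        g.smooth.continuous.continuousAt
    refine ContDiff.sub ?_ (contDiff_id.smul contDiff_const)
    refine contDiff_infty_iff_deriv.2 ⟨fun t => (h t).differentiableAt, ?_⟩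
    rw [show deriv (fun t => ∫ s in (0 : ℝ)..t, g s) = g from funext fun t => (h t).deriv]
    exact g.smooth
  periodic t := by
    have hp : Function.Periodic g (2 * Real.pi) := g.periodic
    have hi : ∀ a b : ℝ, IntervalIntegrable g volume a b :=
      fun a b => g.smooth.continuous.intervalIntegrable a b
    have h1 : (∫ s in (0 : ℝ)..(t + 2 * Real.pi), g s) =
        (∫ s in (0 : ℝ)..t, g s) + ∫ s in (0 : ℝ)..(2 * Real.pi), g s := by
      rw [← intervalIntegral.integral_add_adjacent_intervals (hi 0 t) (hi t (t + 2 * Real.pi)),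
        hp.intervalIntegral_add_eq t 0, zero_add]
    have h2 : (2 * Real.pi) • g.avg = ∫ s in (0 : ℝ)..(2 * Real.pi), g s := by
      rw [avg, smul_inv_smul₀ (by positivity)]
    rw [h1, add_smul, h2]
    abel

/-- The function `e^g`. -/
def cexp (g : SmoothTorus ℂ) : SmoothTorus ℂ :=
  ⟨fun t => Complex.exp (g t), g.smooth.cexp, fun t => congrArg Complex.exp (g.periodic t)⟩

theorem bounded (g : SmoothTorus ℂ) : ∃ C : ℝ, 0 ≤ C ∧ ∀ t, ‖g t‖ ≤ C := by
  have hp : Function.Periodic g (2 * Real.pi) := g.periodic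
  obtain ⟨C, hC⟩ := (isCompact_Icc (a := (0 : ℝ)) (b := 2 * Real.pi)).exists_bound_of_continuousOn
    g.smooth.continuous.continuousOn
  have h (t : ℝ) : ‖g t‖ ≤ C := by
    obtain ⟨s, hs, e⟩ := hp.exists_mem_Ico₀ (by positivity) t
    rw [e]
    exact hC s ⟨hs.1, hs.2.le⟩
  exact ⟨C, (norm_nonneg _).trans (h 0), h⟩

/-- Functions of `t` alone are multipliers. -/
theorem isMultiplier (g : SmoothTorus ℂ) : IsMultiplier (fun p => g p.1) := by
  have hs : ∀ g : SmoothTorus ℂ, ContDiff ℝ ∞ (fun p : ℝ × ℝ => g p.1) :=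
    fun g => g.smooth.comp contDiff_fst
  have hx : ∀ g : SmoothTorus ℂ, dx (fun p => g p.1) = 0 := fun g => by funext p; simp [dx]
  have key : ∀ α β : ℕ, ∀ g : SmoothTorus ℂ, PolyGrowth (mixedDeriv α β (fun p => g p.1)) := by
    intro α β
    cases β with
    | succ k =>
      intro g
      rw [← mixedDeriv_dx, hx]
      exact IsMultiplier.zero.growth α k
    | zero =>
      induction α with
      | zero =>
        intro g
        obtain ⟨C, h0, hC⟩ := g.bounded
        exact ⟨0, C, h0, fun p => by simpa [mixedDeriv] using hC p.1⟩
      | succ k ih =>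
        intro g
        rw [← mixedDeriv_dt (hs g)]
        exact ih ⟨deriv g, (contDiff_infty_iff_deriv.1 g.smooth).2, fun t => by
          rw [← deriv_comp_add_const]
          congr 1
          funext s
          exact g.periodic s⟩
  exact ⟨hs g, fun t _ => g.periodic t, fun α β => key α β g⟩

/-- `(t, ξ) ↦ e^{i ξ A(t)}` is a multiplier for real valued `A`. -/
theorem isMultiplier_exp (A : SmoothTorus ℝ) :
    IsMultiplier (fun p => Complex.exp (Complex.I * (p.2 * A p.1 : ℝ))) := by
  refine IsMultiplier.exp_I (φ := fun p => p.2 * A p.1) ?_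
  have h := IsMultiplier.coordX.mul A.ofReal.isMultiplier
  have e : (fun p : ℝ × ℝ => ((p.2 * A p.1 : ℝ) : ℂ)) =
      (fun p => (p.2 : ℂ)) * fun p => A.ofReal p.1 := by
    funext p
    exact Complex.ofReal_mul _ _
  rw [e]
  exact h

end SmoothTorus

/-- The space `𝒮'(𝕋¹ × ℝ)`, the topological dual of `𝒮(𝕋¹ × ℝ)`. -/
abbrev TemperedTR : Type := SchwartzTR →L[ℂ] ℂ

/-- The measure `dt dx` on `𝕋¹ × ℝ`. -/
def measureTR : Measure (ℝ × ℝ) :=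
  ((volume : Measure ℝ).restrict (Set.Ioc 0 (2 * Real.pi))).prod volume

theorem integrable_TR (f : SchwartzTR) : Integrable f measureTR := by
  have h : Integrable (fun p : ℝ × ℝ => (2 * pN 2 f) * (1 + p.2 ^ 2)⁻¹) measureTR :=
    (integrable_const (2 * pN 2 f)).mul_prod integrable_inv_one_add_sq
  exact h.mono' f.smooth.continuous.aestronglyMeasurable
    (Filter.Eventually.of_forall (norm_le_inv f))

theorem norm_le_pN_zero (f : SchwartzTR) (p : ℝ × ℝ) : ‖f p‖ ≤ pN 0 f := by
  simpa [mixedDeriv] using le_pN (α := 0) (β := 0) (γ := 0) (N := 0) le_rfl f p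

theorem integrable_mul_TR (f g : SchwartzTR) : Integrable (fun p => f p * g p) measureTR :=
  (integrable_TR f).mul_bdd (c := pN 0 g) g.smooth.continuous.aestronglyMeasurable
    (Filter.Eventually.of_forall (norm_le_pN_zero g))

/-- The functional `g ↦ ∫ f g dt dx`, as a linear map. -/
def toDistLM (f : SchwartzTR) : SchwartzTR →ₗ[ℂ] ℂ where
  toFun g := ∫ p, f p * g p ∂measureTR
  map_add' g h := by
    rw [← integral_add (integrable_mul_TR f g) (integrable_mul_TR f h)]
    congr 1
    funext p
    exact mul_add _ _ _
  map_smul' c g := by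
    rw [RingHom.id_apply, smul_eq_mul, ← integral_const_mul]
    congr 1
    funext p
    exact mul_left_comm _ _ _

theorem toDistLM_continuous (f : SchwartzTR) : Continuous (toDistLM f) := by
  refine withSeminorms.continuous_normedSpace_rng ℂ (toDistLM f)
    ⟨{0}, ⟨∫ p, ‖f p‖ ∂measureTR, integral_nonneg fun _ => norm_nonneg _⟩, fun g => ?_⟩
  simp only [Finset.sup_singleton]
  change ‖∫ p, f p * g p ∂measureTR‖ ≤ (∫ p, ‖f p‖ ∂measureTR) * pN 0 g
  rw [← integral_mul_const]
  refine norm_integral_le_of_norm_le ((integrable_TR f).norm.mul_const _)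
    (Filter.Eventually.of_forall fun p => ?_)
  rw [norm_mul]
  exact mul_le_mul_of_nonneg_left (norm_le_pN_zero g p) (norm_nonneg _)

/-- The inclusion `𝒮(𝕋¹ × ℝ) ⊂ 𝒮'(𝕋¹ × ℝ)`, `⟨f, g⟩ = ∫ f g dt dx`. -/
def toDist (f : SchwartzTR) : TemperedTR := ⟨toDistLM f, toDistLM_continuous f⟩

/-- The transpose of an operator of `𝒮(𝕋¹ × ℝ)`: `⟨Tᵗ u, f⟩ = ⟨u, T f⟩`. -/
def transpose (T : SchwartzTR →L[ℂ] SchwartzTR) : TemperedTR →ₗ[ℂ] TemperedTR where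
  toFun u := u.comp T
  map_add' _ _ := rfl
  map_smul' _ _ := rfl

/-- `∂_t` on distributions: `⟨∂_t u, f⟩ = -⟨u, ∂_t f⟩`. -/
def distDt : TemperedTR →ₗ[ℂ] TemperedTR := -transpose dtCLM

/-- `∂_x` on distributions: `⟨∂_x u, f⟩ = -⟨u, ∂_x f⟩`. -/
def distDx : TemperedTR →ₗ[ℂ] TemperedTR := -transpose dxCLM

/-- Multiplication of distributions by a multiplier: `⟨m u, f⟩ = ⟨u, m f⟩`. -/
def distMul {m : ℝ × ℝ → ℂ} (hm : IsMultiplier m) : TemperedTR →ₗ[ℂ] TemperedTR :=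
  transpose (mulCLM hm)

/-- The partial Fourier transform of distributions. -/
def distFourierX : TemperedTR →ₗ[ℂ] TemperedTR := transpose fourierX

/-- The inverse partial Fourier transform of distributions. -/
def distFourierXInv : TemperedTR →ₗ[ℂ] TemperedTR := transpose fourierXInv

/-- The operator `L = ∂_t + a(t) ∂_x + q(t)` on `𝒮'(𝕋¹ × ℝ)`. -/
def opL (a : SmoothTorus ℝ) (q : SmoothTorus ℂ) : TemperedTR →ₗ[ℂ] TemperedTR :=
  distDt + distMul a.ofReal.isMultiplier ∘ₗ distDx + distMul q.isMultiplier

/-- The operator `L_0 = ∂_t + a_0 ∂_x + q_0`, with the averages of `a` and `q`. -/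
def opL0 (a : SmoothTorus ℝ) (q : SmoothTorus ℂ) : TemperedTR →ₗ[ℂ] TemperedTR :=
  opL (SmoothTorus.const a.avg) (SmoothTorus.const q.avg)

/-- Schwartz global hypoellipticity of an operator `P` on `𝒮'(𝕋¹ × ℝ)`. -/
def IsSGH (P : TemperedTR →ₗ[ℂ] TemperedTR) : Prop :=
  ∀ u : TemperedTR, (∃ f : SchwartzTR, P u = toDist f) → ∃ v : SchwartzTR, u = toDist v

/-- `Ψ_a u = ℱ⁻¹ (e^{i ξ A(t)} ℱ u)` on distributions, where `A(t) = ∫_0^t a(s) ds - a_0 t`. -/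
def psiA (a : SmoothTorus ℝ) : TemperedTR →ₗ[ℂ] TemperedTR :=
  distFourierXInv ∘ₗ distMul a.primitive.isMultiplier_exp ∘ₗ distFourierX

/-- `Ψ_q u = e^{Q(t)} u` on distributions, where `Q(t) = ∫_0^t q(s) ds - q_0 t`. -/
def psiQ (q : SmoothTorus ℂ) : TemperedTR →ₗ[ℂ] TemperedTR :=
  distMul q.primitive.cexp.isMultiplier

/-- `Ψ = Ψ_a ∘ Ψ_q` on distributions. -/
def psi (a : SmoothTorus ℝ) (q : SmoothTorus ℂ) : TemperedTR →ₗ[ℂ] TemperedTR :=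
  psiA a ∘ₗ psiQ q

/-- `Ψ_a` on functions: `Ψ_a f = ℱ⁻¹ (e^{i ξ A(t)} ℱ f)`. -/
def psiAFun (a : SmoothTorus ℝ) : SchwartzTR →L[ℂ] SchwartzTR :=
  fourierXInv ∘L mulCLM a.primitive.isMultiplier_exp ∘L fourierX

/-- `Ψ_q` on functions: `Ψ_q f = e^{Q(t)} f`. -/
def psiQFun (q : SmoothTorus ℂ) : SchwartzTR →L[ℂ] SchwartzTR :=
  mulCLM q.primitive.cexp.isMultiplier

end TorusLine

end

noncomputable section

namespace TorusLine

open scoped ContDiff FourierTransform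
open MeasureTheory SchwartzTR

/-! The Fourier multiplier $e^{i\xi A(t)}$ is the translation $x\mapsto x+A(t)$ in disguise, so on
functions $\Psi f(t,x)=e^{Q(t)}f(t,x+A(t))$ (`psi_function_apply`), with inverse
$e^{-Q(t)}f(t,x-A(t))$. Both are compositions of continuous operators of $\mathcal S$, which gives
the automorphism without further estimates.

On $\mathcal S'$ everything is a transpose. $\Psi$ is the transpose of `psiTest`, $f\mapsto
e^{Q(t)}f(t,x-A(t))$, and $L$ is the transpose of `opLTest`, so bijectivity and intertwining become
pointwise identities between smooth functions. The decisive one is `psiTest_opLTest`: since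
$A'=a-a_0$ and $Q'=q-q_0$, differentiating $e^{Q(t)}f(t,x-A(t))$ in $t$ produces exactly the terms
that replace $a,q$ by their averages.

The definitions of $\Psi$ on $\mathcal S$ and on $\mathcal S'$ agree under the embedding by
translation invariance of $dx$ (`psi_toDist`). Hypoellipticity then transfers formally, because
$\Psi$ intertwines $L$ and $L_0$ and is bijective on both $\mathcal S$ and $\mathcal S'$. -/

theorem SchwartzTR.ext {f g : SchwartzTR} (h : ∀ t x, f (t, x) = g (t, x)) : f = g :=
  DFunLike.ext f g fun p => h p.1 p.2

theorem SchwartzTR.continuous_slice (f : SchwartzTR) (t : ℝ) : Continuous fun x => f (t, x) :=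
  f.smooth.continuous.comp (by fun_prop)

/-! ### Inversion of the partial Fourier transform -/

theorem fourierX_eq_osc (f : SchwartzTR) (p : ℝ × ℝ) : fourierX f p = osc (-1) f p := rfl

theorem fourierXInv_eq_osc (f : SchwartzTR) (p : ℝ × ℝ) :
    fourierXInv f p = (2 * Real.pi : ℂ)⁻¹ * osc 1 f p := rfl

/-- The phase depends on $s$ and $\xi$ only through $s\xi$. Hence the two transforms differ by a
reflection and a constant, which yields the second inversion formula from the first. -/
theorem osc_neg (s : ℝ) (f : ℝ × ℝ → ℂ) (t ξ : ℝ) : osc (-s) f (t, ξ) = osc s f (t, -ξ) := by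
  simp only [osc]
  congr 1
  funext x
  congr 4
  ring

/-- The partial Fourier transform in terms of the Fourier transform of a slice. -/
theorem fourierX_eq_fourier (f : SchwartzTR) (t w : ℝ) :
    fourierX f (t, 2 * Real.pi * w) = 𝓕 (fun x => f (t, x)) w := by
  -- The kernel of `𝓕` is $e^{-2\pi i xw}$, hence the frequency $\xi=2\pi w$.
  rw [fourierX_eq_osc, osc, Real.fourier_eq']
  congr 1
  funext x
  simp only [smul_eq_mul, RCLike.inner_apply, conj_trivial]
  congr 4
  ring

/-- For each fixed $t$ this is classical Fourier inversion for a continuous integrable function with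
integrable transform, up to the normalisation of `𝓕`. -/
theorem fourierXInv_fourierX (f : SchwartzTR) : fourierXInv (fourierX f) = f := by
  refine SchwartzTR.ext fun t x => ?_
  have hpi : (2 * Real.pi) ≠ 0 := by positivity
  have hF : 𝓕 (fun x => f (t, x)) = fun w => fourierX f (t, 2 * Real.pi * w) :=
    funext fun w => (fourierX_eq_fourier f t w).symm
  have hi : Integrable (𝓕 fun x => f (t, x)) := by
    rw [hF]
    -- The transform is itself in $\mathcal S$, so its slices are integrable, also after rescaling.
    exact (integrable_slice (fourierX f) t).comp_mul_left' hpi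
  have h := congrFun ((f.continuous_slice t).fourierInv_fourier_eq (integrable_slice f t) hi) x
  rw [← h, Real.fourierInv_eq', hF, fourierXInv_eq_osc, osc]
  -- The substitution $\xi=2\pi w$ has Jacobian factor $(2\pi)^{-1}$, the constant in `fourierXInv`.
  have hs := Measure.integral_comp_mul_left (fun ξ : ℝ =>
    Complex.exp (((1 * ξ * x : ℝ) : ℂ) * Complex.I) * fourierX f (t, ξ)) (2 * Real.pi)
  rw [abs_of_pos (by positivity), Complex.real_smul] at hs
  push_cast at hs ⊢
  rw [← hs]
  congr 1
  funext w
  simp only [smul_eq_mul, RCLike.inner_apply, conj_trivial]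
  congr 3
  push_cast
  ring

theorem fourierX_fourierXInv (f : SchwartzTR) : fourierX (fourierXInv f) = f := by
  refine SchwartzTR.ext fun t x => ?_
  rw [← congrArg (fun g : SchwartzTR => g (t, x)) (fourierXInv_fourierX f)]
  simp only [fourierXInv_eq_osc (fourierX f), fourierX_eq_osc (fourierXInv f), osc]
  -- Reflecting the integration variable turns the outer kernel of one transform into that of the
  -- other; `osc_neg` does the same for the inner one.
  rw [← integral_const_mul, ← integral_neg_eq_self]
  congr 1
  funext ξ
  rw [fourierXInv_eq_osc, fourierX_eq_osc, osc_neg 1, mul_left_comm]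
  congr 4
  ring_nf

/-! ### Conjugated multipliers as translations -/

/-- Conjugating the multiplier `e^{i ξ A(t)}` by the partial Fourier transform gives the
translation `x ↦ x + A(t)`. -/
theorem fourierXInv_mul_fourierX (A : SmoothTorus ℝ) (f : SchwartzTR) (t x : ℝ) :
    fourierXInv (mulCLM A.isMultiplier_exp (fourierX f)) (t, x) = f (t, x + A t) := by
  -- With $f(t,x+A)$ written as an inverse transform, it remains to merge $e^{i\xi
  -- A}e^{ix\xi}=e^{i(x+A)\xi}$ under the integral.
  rw [← congrArg (fun g : SchwartzTR => g (t, x + A t)) (fourierXInv_fourierX f)]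
  simp only [fourierXInv_eq_osc, osc, mulCLM_apply]
  congr 2
  funext ξ
  rw [← mul_assoc, ← Complex.exp_add]
  congr 2
  push_cast
  ring

/-- The outer kernel is now $e^{-ix\xi}$, so the same factor translates in the opposite direction.
This order of the transforms is the one that acts on test functions. -/
theorem fourierX_mul_fourierXInv (A : SmoothTorus ℝ) (f : SchwartzTR) (t x : ℝ) :
    fourierX (mulCLM A.isMultiplier_exp (fourierXInv f)) (t, x) = f (t, x - A t) := by
  rw [← congrArg (fun g : SchwartzTR => g (t, x - A t)) (fourierX_fourierXInv f)]
  simp only [fourierX_eq_osc, osc, mulCLM_apply]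
  congr 1
  funext ξ
  rw [← mul_assoc, ← Complex.exp_add]
  congr 2
  push_cast
  ring

/-- The function `-g`. -/
def SmoothTorus.neg (g : SmoothTorus ℂ) : SmoothTorus ℂ :=
  ⟨fun t => -g t, g.smooth.neg, fun t => congrArg Neg.neg (g.periodic t)⟩

/-- This is the identity $A'=a-a_0$, $Q'=q-q_0$ behind the reduction to constant coefficients. -/
theorem SmoothTorus.hasDerivAt_primitive {E : Type} [NormedAddCommGroup E] [NormedSpace ℝ E]
    [CompleteSpace E] (g : SmoothTorus E) (t : ℝ) : HasDerivAt g.primitive (g t - g.avg) t := by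
  have h : HasDerivAt (fun t => ∫ s in (0 : ℝ)..t, g s) (g t) t :=
    intervalIntegral.integral_hasDerivAt_right (g.smooth.continuous.intervalIntegrable _ _)
      g.smooth.continuous.aestronglyMeasurable.stronglyMeasurableAtFilter
      g.smooth.continuous.continuousAt
  exact (h.sub ((hasDerivAt_id t).smul_const g.avg)).congr_deriv (by rw [one_smul])

/-! ### The automorphism of the Schwartz space -/

theorem psi_function_apply (a : SmoothTorus ℝ) (q : SmoothTorus ℂ) (f : SchwartzTR) (t x : ℝ) :
    psiAFun a (psiQFun q f) (t, x) =
      Complex.exp (q.primitive t) * f (t, x + a.primitive t) :=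
  fourierXInv_mul_fourierX a.primitive (psiQFun q f) t x

/-- The inverse of `Ψ` on functions. -/
def psiFunInv (a : SmoothTorus ℝ) (q : SmoothTorus ℂ) : SchwartzTR →L[ℂ] SchwartzTR :=
  mulCLM q.primitive.neg.cexp.isMultiplier ∘L
    fourierX ∘L mulCLM a.primitive.isMultiplier_exp ∘L fourierXInv

/-- The exponential factor depends on $t$ alone, so it commutes with translation in $x$ and may be
applied after it. -/
theorem psiFunInv_apply (a : SmoothTorus ℝ) (q : SmoothTorus ℂ) (f : SchwartzTR) (t x : ℝ) :
    psiFunInv a q f (t, x) =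
      Complex.exp (-q.primitive t) * f (t, x - a.primitive t) :=
  congrArg (Complex.exp (-q.primitive t) * ·) (fourierX_mul_fourierXInv a.primitive f t x)

/-- The automorphism `Ψ` of `𝒮(𝕋¹ × ℝ)`. -/
def psiEquiv (a : SmoothTorus ℝ) (q : SmoothTorus ℂ) : SchwartzTR ≃L[ℂ] SchwartzTR :=
  -- Both directions are compositions of continuous operators, so only the two pointwise inverse
  -- identities remain.
  ContinuousLinearEquiv.equivOfInverse (psiAFun a ∘L psiQFun q) (psiFunInv a q)
    (fun f => SchwartzTR.ext fun t x => by
      rw [psiFunInv_apply, ContinuousLinearMap.comp_apply, psi_function_apply, ← mul_assoc,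
        ← Complex.exp_add]
      simp)
    (fun f => SchwartzTR.ext fun t x => by
      rw [ContinuousLinearMap.comp_apply, psi_function_apply, psiFunInv_apply, ← mul_assoc,
        ← Complex.exp_add]
      simp)

/-! ### The bijection of the distribution space -/

/-- The operator of `𝒮(𝕋¹ × ℝ)` whose transpose is `Ψ`. -/
def psiTest (a : SmoothTorus ℝ) (q : SmoothTorus ℂ) : SchwartzTR →L[ℂ] SchwartzTR :=
  psiQFun q ∘L fourierX ∘L mulCLM a.primitive.isMultiplier_exp ∘L fourierXInv

theorem psiTest_apply (a : SmoothTorus ℝ) (q : SmoothTorus ℂ) (f : SchwartzTR) (t x : ℝ) :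
    psiTest a q f (t, x) = Complex.exp (q.primitive t) * f (t, x - a.primitive t) :=
  congrArg (Complex.exp (q.primitive t) * ·) (fourierX_mul_fourierXInv a.primitive f t x)

/-- Each factor of $\Psi$ is defined as a transpose and transposition reverses composition. Hence
the two Fourier transforms trade places and $e^{Q}$ acts last. -/
theorem psi_eq_transpose (a : SmoothTorus ℝ) (q : SmoothTorus ℂ) :
    psi a q = transpose (psiTest a q) := rfl

/-- The inverse of `psiTest`. -/
def psiTestInv (a : SmoothTorus ℝ) (q : SmoothTorus ℂ) : SchwartzTR →L[ℂ] SchwartzTR :=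
  mulCLM q.primitive.neg.cexp.isMultiplier ∘L psiAFun a

theorem psiTestInv_apply (a : SmoothTorus ℝ) (q : SmoothTorus ℂ) (f : SchwartzTR) (t x : ℝ) :
    psiTestInv a q f (t, x) = Complex.exp (-q.primitive t) * f (t, x + a.primitive t) :=
  congrArg (Complex.exp (-q.primitive t) * ·) (fourierXInv_mul_fourierX a.primitive f t x)

theorem psiTestInv_psiTest (a : SmoothTorus ℝ) (q : SmoothTorus ℂ) (f : SchwartzTR) :
    psiTestInv a q (psiTest a q f) = f := SchwartzTR.ext fun t x => by
  rw [psiTestInv_apply, psiTest_apply, ← mul_assoc, ← Complex.exp_add]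
  simp

theorem psiTest_psiTestInv (a : SmoothTorus ℝ) (q : SmoothTorus ℂ) (f : SchwartzTR) :
    psiTest a q (psiTestInv a q f) = f := SchwartzTR.ext fun t x => by
  rw [psiTest_apply, psiTestInv_apply, ← mul_assoc, ← Complex.exp_add]
  simp

/-- The linear bijection `Ψ` of `𝒮'(𝕋¹ × ℝ)`. -/
def psiDistEquiv (a : SmoothTorus ℝ) (q : SmoothTorus ℂ) : TemperedTR ≃ₗ[ℂ] TemperedTR :=
  LinearEquiv.ofLinearMap (psi a q) (transpose (psiTestInv a q))
    -- The order reverses again: a right inverse on distributions comes from a left inverse on test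
    -- functions.
    (LinearMap.ext fun u => ContinuousLinearMap.ext fun f =>
      congrArg u (psiTestInv_psiTest a q f))
    (LinearMap.ext fun u => ContinuousLinearMap.ext fun f =>
      congrArg u (psiTest_psiTestInv a q f))

/-- Duality turns $x-A(t)$ on the test function into $x+A(t)$ on $f$, by Fubini and translation
invariance of $dx$ for each fixed $t$. It identifies the two definitions of $\Psi$. -/
theorem psi_toDist (a : SmoothTorus ℝ) (q : SmoothTorus ℂ) (f : SchwartzTR) :
    psi a q (toDist f) = toDist (psiEquiv a q f) := by
  refine ContinuousLinearMap.ext fun g => ?_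
  change ∫ p, f p * psiTest a q g p ∂measureTR = ∫ p, psiAFun a (psiQFun q f) p * g p ∂measureTR
  rw [measureTR, integral_prod _ (integrable_mul_TR f _), integral_prod _ (integrable_mul_TR _ g)]
  congr 1
  funext t
  -- Substituting $x\mapsto x+A(t)$ moves the shift from $g$ to $f$.
  rw [← integral_add_right_eq_self _ (a.primitive t)]
  congr 1
  funext x
  rw [psiTest_apply, psi_function_apply, add_sub_cancel_right]
  ring

/-! ### The intertwining relations -/

/-- The operator `f ↦ -∂_t f - ∂_x (a f) + q f` of `𝒮(𝕋¹ × ℝ)`, whose transpose is `L`. -/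
def opLTest (a : SmoothTorus ℝ) (q : SmoothTorus ℂ) : SchwartzTR →L[ℂ] SchwartzTR :=
  -dtCLM - dxCLM ∘L mulCLM a.ofReal.isMultiplier + mulCLM q.isMultiplier

/-- Each derivative carries a minus sign by duality, and transposing $a\,\partial_x$ puts $a$ inside
the derivative. -/
theorem opL_eq_transpose (a : SmoothTorus ℝ) (q : SmoothTorus ℂ) :
    opL a q = transpose (opLTest a q) := by
  refine LinearMap.ext fun u => ContinuousLinearMap.ext fun f => ?_
  change -u (dtCLM f) + -u (dxCLM (mulCLM a.ofReal.isMultiplier f)) + u (mulCLM q.isMultiplier f) =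
    u (-dtCLM f - dxCLM (mulCLM a.ofReal.isMultiplier f) + mulCLM q.isMultiplier f)
  rw [map_add, map_sub, map_neg, sub_eq_add_neg]

/-- Since $a$ does not depend on $x$, it passes through $\partial_x$ and leaves no zero-order term.
-/
theorem opLTest_apply (a : SmoothTorus ℝ) (q : SmoothTorus ℂ) (f : SchwartzTR) (t x : ℝ) :
    opLTest a q f (t, x) = -dt f (t, x) - a t * dx f (t, x) + q t * f (t, x) := by
  have h : dx (fun p : ℝ × ℝ => (a p.1 : ℂ) * f p) (t, x) = a t * dx f (t, x) :=
    deriv_const_mul_field (a t : ℂ) (v := fun y => f (t, y))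
  rw [← h]
  rfl

/-- This is the core computation. The $t$-derivative of $e^{Q}f(t,x-A)$ contributes $(q-q_0)f$ from
the exponential and $-(a-a_0)\partial_x f$ from the shift. After the sign change in $-\partial_t$
these combine with $-a\,\partial_x f+qf$ to leave $-a_0\partial_x f+q_0f$. -/
theorem psiTest_opLTest (a : SmoothTorus ℝ) (q : SmoothTorus ℂ) (f : SchwartzTR) :
    psiTest a q (opLTest (.const a.avg) (.const q.avg) f) = opLTest a q (psiTest a q f) := by
  refine SchwartzTR.ext fun t x => ?_
  have hf : HasFDerivAt f (fderiv ℝ f (t, x - a.primitive t)) (t, x - a.primitive t) :=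
    (f.smooth.differentiable (by simp) _).hasFDerivAt
  have ht : dt (psiTest a q f) (t, x) = Complex.exp (q.primitive t) * (q t - q.avg) *
      f (t, x - a.primitive t) + Complex.exp (q.primitive t) *
      (dt f (t, x - a.primitive t) + (-(a t - a.avg) : ℝ) * dx f (t, x - a.primitive t)) := by
    -- The curve $s\mapsto(s,x-A(s))$ along which $f$ is differentiated has second velocity
    -- component $-(a-a_0)$.
    have h1 : HasDerivAt (fun s => (s, x - a.primitive s)) ((1 : ℝ), -(a t - a.avg)) t :=
      (hasDerivAt_id t).prodMk ((a.hasDerivAt_primitive t).const_sub x)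
    have h2 := (q.hasDerivAt_primitive t).cexp.mul (hf.comp_hasDerivAt t h1)
    rw [fderiv_eq f.smooth] at h2
    have e : (fun s => psiTest a q f (s, x)) =
        (fun s => Complex.exp (q.primitive s)) * (f ∘ fun s => (s, x - a.primitive s)) :=
      funext fun s => psiTest_apply a q f s x
    rw [dt]
    simp only
    rw [e, h2.deriv]
    simp
  have hx : dx (psiTest a q f) (t, x) =
      Complex.exp (q.primitive t) * dx f (t, x - a.primitive t) := by
    have h : (fun y => psiTest a q f (t, y)) =
        fun y => Complex.exp (q.primitive t) * f (t, y - a.primitive t) :=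
      funext fun y => psiTest_apply a q f t y
    rw [dx]
    simp only
    rw [h, deriv_const_mul_field, deriv_comp_sub_const (f := fun y => f (t, y)), dx]
  rw [psiTest_apply, opLTest_apply, opLTest_apply, ht, hx, psiTest_apply]
  simp only [SmoothTorus.const]
  push_cast
  ring

/-- $L_0$ is an instance of `opL` with constant coefficients, so both operators are transposes and
the relation is the dual of `psiTest_opLTest`. -/
theorem opL0_comp_psi (a : SmoothTorus ℝ) (q : SmoothTorus ℂ) :
    opL0 a q ∘ₗ psi a q = psi a q ∘ₗ opL a q := by
  rw [opL0, opL_eq_transpose, opL_eq_transpose, psi_eq_transpose]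
  exact LinearMap.ext fun u => ContinuousLinearMap.ext fun f =>
    congrArg u (psiTest_opLTest a q f)

theorem opL_comp_psi_symm (a : SmoothTorus ℝ) (q : SmoothTorus ℂ) :
    opL a q ∘ₗ (psiDistEquiv a q).symm.toLinearMap =
      (psiDistEquiv a q).symm.toLinearMap ∘ₗ opL0 a q := by
  -- After applying the injective $\Psi$, both sides equal $L_0u$.
  refine LinearMap.ext fun u => (psiDistEquiv a q).injective ?_
  have h := LinearMap.congr_fun (opL0_comp_psi a q) ((psiDistEquiv a q).symm u)
  have e (v : TemperedTR) : psi a q ((psiDistEquiv a q).symm v) = v :=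
    (psiDistEquiv a q).apply_symm_apply v
  change psi a q (opL a q ((psiDistEquiv a q).symm u)) =
    psi a q ((psiDistEquiv a q).symm (opL0 a q u))
  rw [e]
  exact h.symm.trans (congrArg (opL0 a q) (e u))

/-! ### Transfer of global hypoellipticity -/

/-- Schwartz global hypoellipticity passes along an intertwining bijection of `𝒮'(𝕋¹ × ℝ)` that
restricts to a bijection of `𝒮(𝕋¹ × ℝ)`. -/
theorem isSGH_iff_of_intertwining {P R : TemperedTR →ₗ[ℂ] TemperedTR}
    (Φ : SchwartzTR ≃L[ℂ] SchwartzTR) (Ψ : TemperedTR ≃ₗ[ℂ] TemperedTR)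
    (hΦ : ∀ f, Ψ (toDist f) = toDist (Φ f)) (h : ∀ u, R (Ψ u) = Ψ (P u)) :
    IsSGH P ↔ IsSGH R := by
  constructor
  · rintro hP u ⟨f, hf⟩
    -- If $Ru=f$, then $P\Psi^{-1}u=\Psi^{-1}Ru=\Phi^{-1}f$ is Schwartz, so the hypothesis on $P$
    -- applies to $\Psi^{-1}u$.
    obtain ⟨v, hv⟩ := hP (Ψ.symm u) ⟨Φ.symm f, Ψ.injective (by
      rw [← h, Ψ.apply_symm_apply, hf, hΦ, Φ.apply_symm_apply])⟩
    exact ⟨Φ v, by rw [← hΦ, ← hv, Ψ.apply_symm_apply]⟩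
  · rintro hR u ⟨f, hf⟩
    obtain ⟨v, hv⟩ := hR (Ψ u) ⟨Φ f, by rw [h, hf, hΦ]⟩
    exact ⟨Φ.symm v, Ψ.injective (by rw [hv, hΦ, Φ.apply_symm_apply])⟩

end TorusLine

end

theorem mainTheorem2 (a : TorusLine.SmoothTorus ℝ) (q : TorusLine.SmoothTorus ℂ) :
    (∃ Φ : TorusLine.SchwartzTR ≃L[ℂ] TorusLine.SchwartzTR,
      (∀ f, Φ f = TorusLine.psiAFun a (TorusLine.psiQFun q f)) ∧
      ∀ f, TorusLine.psi a q (TorusLine.toDist f) = TorusLine.toDist (Φ f)) ∧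
    (∃ Ψ : TorusLine.TemperedTR ≃ₗ[ℂ] TorusLine.TemperedTR,
      Ψ.toLinearMap = TorusLine.psi a q ∧
      TorusLine.opL0 a q ∘ₗ Ψ.toLinearMap = Ψ.toLinearMap ∘ₗ TorusLine.opL a q ∧
      TorusLine.opL a q ∘ₗ Ψ.symm.toLinearMap =
        Ψ.symm.toLinearMap ∘ₗ TorusLine.opL0 a q) ∧
    (TorusLine.IsSGH (TorusLine.opL a q) ↔ TorusLine.IsSGH (TorusLine.opL0 a q)) :=
  ⟨⟨TorusLine.psiEquiv a q, fun _ => rfl, TorusLine.psi_toDist a q⟩,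
    ⟨TorusLine.psiDistEquiv a q, rfl, TorusLine.opL0_comp_psi a q,
      TorusLine.opL_comp_psi_symm a q⟩,
    TorusLine.isSGH_iff_of_intertwining (TorusLine.psiEquiv a q) (TorusLine.psiDistEquiv a q)
      (TorusLine.psi_toDist a q) (LinearMap.congr_fun (TorusLine.opL0_comp_psi a q))⟩
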